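/- Let $E$ and $F$ be nonzero real Banach spaces with duals $E^*,F^*$ and biduals $E^{**},F^{**}$, let $\widehat{\cdot}$ denote the canonical embedding of a space into its bidual, and let $\langle\cdot,\cdot\rangle$ denote the duality pairings. For a bounded linear map $T$ let $T^{\mathsf T}$ be its Banach-space adjoint and $T^{\mathsf{TT}}=(T^{\mathsf T})^{\mathsf T}$. For $f\colon E\times E^*\to\,]-\infty,\infty]$ let $\operatorname{dom} f=\{f<\infty\}$, let $$f^*(x^*,x^{**})=\sup_{(y,y^*)\in E\times E^*}\bigl[\langle y,x^*\rangle+\langle y^*,x^{**}\rangle-f(y,y^*)\bigr]\qquad\bigl((x^*,x^{**})\in E^*\times E^{**}\bigr),$$ and let $\mathcal M f\colon E\rightrightarrows E^*$ be the multifunction with graph $\{(x,x^*)\colon f(x,x^*)=\langle x,x^*\rangle\}$; similarly $\mathcal M f^*\colon E^*\rightrightarrows E^{**}$ has graph $\{(x^*,x^{**})\colon f^*(x^*,x^{**})=\langle x^*,x^{**}\rangle\}$. The function $f$ is *strongly representative* on $E\times E^*$ if it is proper, convex and (norm) lower semicontinuous, $f(x,x^*)\ge\langle x,x^*\rangle$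 for all $(x,x^*)\in E\times E^*$, and $f^*(x^*,x^{**})\ge\langle x^*,x^{**}\rangle$ for all $(x^*,x^{**})\in E^*\times E^{**}$. A multifunction $S\colon E\rightrightarrows E^*$ is *strongly representable* if $S=\mathcal M k$ for some strongly representative function $k$ on $E\times E^*$. The same notions are used for $F$. Sums, inverses and compositions of multifunctions (with each other or with linear maps) are the usual ones, $\mathcal R(\cdot)$ is the range of a multifunction, and $\pi_E,\pi_{E^*},\pi_F,\pi_{F^*}$ are the coordinate projections of $E\times E^*$ and $F\times F^*$. Let $f$ be a strongly representative function on $E\times E^*$ and $g$ a strongly representative function on $F\times F^*$. (a) Let $A\colon E\to F$ be bounded and linear and let $\bigcup_{\lambda>0}\lambda\bigl[\pi_F\operatorname{dom} g-A(\pi_E\operatorname{dom} f)\bigr]$ be a closed subspace of $F$. Then the multifunction $\mathcal M f+A^{\mathsf T}(\mathcal M g)A\colon E\rightrightarrows E^*$ is strongly representable. (b) Let $B\colon F\to E$ be bounded and linear and let $\bigcup_{\lambda>0}\lambda\bigl[\pi_{F^*}\operatorname{dom} g-B^{\mathsf T}(\pi_{E^*}\operatorname{dom} f)\bigr]$ be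 a closed subspace of $F^*$. Then the multifunction $x\mapsto\bigl((\mathcal M f^*)+B^{\mathsf{TT}}(\mathcal M g^*)B^{\mathsf T}\bigr)^{-1}\widehat x$ from $E$ to $E^*$ is strongly representable. (c) Let $B\colon F\to E$ be bounded and linear, let $\bigcup_{\lambda>0}\lambda\bigl[\pi_{F^*}\operatorname{dom} g-B^{\mathsf T}(\pi_{E^*}\operatorname{dom} f)\bigr]$ be a closed subspace of $F^*$, and let $\mathcal R(\mathcal M g^*)\subset\widehat F$, where $\widehat F=\{\widehat y\colon y\in F\}$. Then the multifunction $\bigl((\mathcal M f)^{-1}+B(\mathcal M g)^{-1}B^{\mathsf T}\bigr)^{-1}\colon E\rightrightarrows E^*$ is strongly representable. -/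

import Mathlib

open scoped Pointwise

noncomputable section

namespace StrongRep

/-- The effective domain of an extended-real-valued function. -/
def effDom {X : Type*} (f : X → EReal) : Set X := {x | f x < ⊤}

/-- Proper, convex, lower semicontinuous functions `X → ]-∞, ∞]`.  Properness: the value `-∞` is
never taken and the value `∞` is not taken everywhere.  Convexity: the epigraph in `X × ℝ` is
convex. -/
structure IsPCLSC {X : Type*} [NormedAddCommGroup X] [NormedSpace ℝ X] (f : X → EReal) : Prop where
  ne_bot : ∀ x, f x ≠ ⊥
  dom_nonempty : (effDom f).Nonempty
  convex_epigraph : Convex ℝ {p : X × ℝ | f p.1 ≤ (p.2 : EReal)}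
  lsc : LowerSemicontinuous f

/-- The Fenchel conjugate of a function on `X × U`, as a function on `X* × U*`, the dual of `X × U`
under the pairing `⟨(x, u), (x*, u*)⟩ = ⟨x, x*⟩ + ⟨u, u*⟩`. -/
def conj {X U : Type*} [NormedAddCommGroup X] [NormedSpace ℝ X]
    [NormedAddCommGroup U] [NormedSpace ℝ U] (f : X × U → EReal) :
    StrongDual ℝ X × StrongDual ℝ U → EReal :=
  fun q => ⨆ p : X × U, ((q.1 p.1 + q.2 p.2 : ℝ) : EReal) - f p

/-- Representative functions on `E × E*`. -/
structure IsRepresentative {E : Type*} [NormedAddCommGroup E] [NormedSpace ℝ E]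
    (f : E × StrongDual ℝ E → EReal) : Prop where
  pclsc : IsPCLSC f
  pairing_le : ∀ (x : E) (x' : StrongDual ℝ E), ((x' x : ℝ) : EReal) ≤ f (x, x')

/-- Strongly representative functions on `E × E*`. -/
structure IsStronglyRepresentative {E : Type*} [NormedAddCommGroup E] [NormedSpace ℝ E]
    (f : E × StrongDual ℝ E → EReal) : Prop where
  representative : IsRepresentative f
  pairing_le_conj : ∀ (x' : StrongDual ℝ E) (x'' : StrongDual ℝ (StrongDual ℝ E)),
    ((x'' x' : ℝ) : EReal) ≤ conj f (x', x'')

/-- The multifunction `M f : E ⇉ E*` with graph `{(x, x*) | f (x, x*) = ⟨x, x*⟩}`.  Multifunctions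
`X ⇉ Y` are functions `X → Set Y`. -/
def M {E : Type*} [NormedAddCommGroup E] [NormedSpace ℝ E]
    (f : E × StrongDual ℝ E → EReal) : E → Set (StrongDual ℝ E) :=
  fun x => {x' | f (x, x') = ((x' x : ℝ) : EReal)}

/-- The inverse of a multifunction. -/
def mInv {X Y : Type*} (S : X → Set Y) : Y → Set X := fun y => {x | y ∈ S x}

/-- The range of a multifunction. -/
def mRange {X Y : Type*} (S : X → Set Y) : Set Y := ⋃ x, S x

/-- A multifunction `S : E ⇉ E*` is strongly representable if `S = M f` for some strongly
representative function `f` on `E × E*`. -/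
def IsStronglyRepresentable {E : Type*} [NormedAddCommGroup E] [NormedSpace ℝ E]
    (S : E → Set (StrongDual ℝ E)) : Prop :=
  ∃ f : E × StrongDual ℝ E → EReal, IsStronglyRepresentative f ∧ M f = S

/-- The Banach space adjoint `Aᵀ : Y* → X*`, `Aᵀ y* = y* ∘ A`. -/
abbrev adj {X Y : Type*} [NormedAddCommGroup X] [NormedSpace ℝ X]
    [NormedAddCommGroup Y] [NormedSpace ℝ Y] (A : X →L[ℝ] Y) :
    StrongDual ℝ Y →L[ℝ] StrongDual ℝ X :=
  A.precomp ℝ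

/-- The cone `⋃ λ > 0, λ C` generated by `C` is a closed linear subspace. -/
def ConeIsClosedSubspace {X : Type*} [NormedAddCommGroup X] [NormedSpace ℝ X] (C : Set X) : Prop :=
  ∃ L : Submodule ℝ X, (L : Set X) = (⋃ (t : ℝ) (_ : 0 < t), t • C) ∧ IsClosed (L : Set X)

end StrongRep

end

namespace StrongRep

/-! Each multifunction is described by a marginal function of `f ⊕ g`: take the infimum of `f z + g
w` over pairs with `T (z, w) = 0` and `P (z, w)` prescribed. For (a) this is `inf over y*` of `f (x,
x* - Aᵀ y*) + g (A x, y*)`; for (b) and (c) it is `inf over y` of `f (x - B y, x*) + g (y, Bᵀ x*)`.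
The marginal lies above the pairing because `f` and `g` do.

The cone condition is an Attouch–Brezis qualification. `exists_multiplier` turns it into a Lagrange
multiplier `η` for `T = 0`, so the conjugate of the marginal is an exact sum of values of `f*` and
`g*`. It therefore lies above the dual pairing, and where it equals the pairing both summands must
do so too.

The marginal need not be lower semicontinuous, so it is replaced by its biconjugate `k`. A convex
set above the pairing lies above the linearization of the pairing at any contact point
(`linearization_le`). Used on a space and on its dual, this shows that contact of `k` at `(x, x')`
is contact of the conjugate at `(x', x̂)`, and likewise identifies `M f` with `M f*` at canonical
elements (`mem_M_iff`). -/

/-! ### An open mapping theorem for closed convex sets. -/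

/-- The weights `1/2, ..., 1/2^n, 1/2^n` sum to one: the mass left over from the geometric series is
put on `d n`. -/
theorem sum_geometric_add_mem {W : Type*} [AddCommGroup W] [Module ℝ W] {D : Set W}
    (hv : Convex ℝ D) (n : ℕ) : ∀ d : ℕ → W, (∀ k, d k ∈ D) →
      ∑ k ∈ Finset.range n, (1 / 2 : ℝ) ^ (k + 1) • d k + (1 / 2 : ℝ) ^ n • d n ∈ D := by
  induction n with
  | zero => intro d hd; simpa using hd 0
  | succ n ih =>
    intro d hd
    have h := hv (hd 0) (ih (fun k => d (k + 1)) fun k => hd _)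
      (by norm_num : (0 : ℝ) ≤ 1 / 2) (by norm_num : (0 : ℝ) ≤ 1 / 2) (by norm_num)
    convert h using 1
    rw [Finset.sum_range_succ', smul_add, Finset.smul_sum]
    simp only [smul_smul, ← pow_succ']
    simp only [zero_add, pow_one]
    abel

/-- Successive approximation: match the residual up to `δ / 2`, double the error to return to the
ball, and repeat. The series `∑ 2^{-(k+1)} d k` has total weight one, so its sum stays in `D`; its
image is `y / 2`. -/
theorem half_smul_mem_image_of_ball_subset_closure {W Y : Type*}
    [NormedAddCommGroup W] [NormedSpace ℝ W] [CompleteSpace W]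
    [NormedAddCommGroup Y] [NormedSpace ℝ Y] {D : Set W}
    (hc : IsClosed D) (hv : Convex ℝ D) {R : ℝ} (hb : ∀ w ∈ D, ‖w‖ ≤ R)
    (T : W →L[ℝ] Y) {δ : ℝ} (hδ : 0 < δ) (h : Metric.ball 0 δ ⊆ closure (T '' D))
    {y : Y} (hy : y ∈ Metric.ball (0 : Y) δ) : (1 / 2 : ℝ) • y ∈ T '' D := by
  have step : ∀ r : Metric.ball (0 : Y) δ, ∃ d ∈ D,
      (2 : ℝ) • ((r : Y) - T d) ∈ Metric.ball (0 : Y) δ := by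
    rintro ⟨r, hr⟩
    obtain ⟨_, ⟨d, hd, rfl⟩, hlt⟩ := Metric.mem_closure_iff.1 (h hr) (δ / 2) (by positivity)
    refine ⟨d, hd, ?_⟩
    rw [dist_eq_norm] at hlt
    rw [mem_ball_zero_iff, norm_smul]
    norm_num
    linarith
  choose dd hdD hdb using step
  let r : ℕ → Metric.ball (0 : Y) δ := fun n => Nat.rec ⟨y, hy⟩ (fun _ r => ⟨_, hdb r⟩) n
  let d : ℕ → W := fun n => dd (r n)
  have hr : ∀ n : ℕ, (r (n + 1)).1 = (2 : ℝ) • ((r n).1 - T (d n)) := by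
    intro n
    rfl
  have hd : ∀ n, d n ∈ D := fun n => hdD _
  have hT : ∀ n, T (∑ k ∈ Finset.range n, (1 / 2 : ℝ) ^ (k + 1) • d k)
      = (1 / 2 : ℝ) • y - (1 / 2 : ℝ) ^ (n + 1) • (r n).1 := by
    intro n
    induction n with
    | zero => simp [r]
    | succ n ih =>
      rw [Finset.sum_range_succ, map_add, ih, map_smul, hr, smul_smul]
      have : (1 / 2 : ℝ) ^ (n + 1 + 1) * 2 = (1 / 2) ^ (n + 1) := by rw [pow_succ]; ring
      rw [this, smul_sub]
      abel
  have hgeo : Summable fun k : ℕ => (1 / 2 : ℝ) ^ (k + 1) * R := by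
    simp only [pow_succ]
    exact ((summable_geometric_of_lt_one (by norm_num) (by norm_num)).mul_right _).mul_right _
  have hsum : Summable fun k : ℕ => (1 / 2 : ℝ) ^ (k + 1) • d k := by
    refine Summable.of_norm_bounded hgeo fun k => ?_
    rw [norm_smul, norm_pow]
    norm_num
    exact hb _ (hd k)
  obtain ⟨x, hx⟩ := hsum
  have hx' := hx.tendsto_sum_nat
  have hp : Filter.Tendsto (fun n : ℕ => (1 / 2 : ℝ) ^ n) Filter.atTop (nhds 0) :=
    tendsto_pow_atTop_nhds_zero_of_lt_one (by norm_num) (by norm_num)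
  have h1 : Filter.Tendsto (fun n : ℕ => (1 / 2 : ℝ) ^ n • d n) Filter.atTop (nhds 0) := by
    refine squeeze_zero_norm (a := fun n => (1 / 2 : ℝ) ^ n * R) (fun n => ?_)
      (by simpa using hp.mul_const R)
    rw [norm_smul, norm_pow]
    norm_num
    exact hb _ (hd n)
  have h2 : Filter.Tendsto (fun n : ℕ => (1 / 2 : ℝ) ^ (n + 1) • (r n).1)
      Filter.atTop (nhds 0) := by
    refine squeeze_zero_norm (a := fun n => (1 / 2 : ℝ) ^ (n + 1) * δ) (fun n => ?_)
      (by simpa using ((Filter.tendsto_add_atTop_iff_nat 1).2 hp).mul_const δ)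
    rw [norm_smul, norm_pow]
    norm_num
    exact (mem_ball_zero_iff.1 (r n).2).le
  refine ⟨x, ?_, ?_⟩
  · have := hx'.add h1
    rw [add_zero] at this
    exact hc.mem_of_tendsto this (Filter.Eventually.of_forall fun n => sum_geometric_add_mem hv n d hd)
  · have e1 := (T.continuous.tendsto x).comp hx'
    have e2 : Filter.Tendsto (fun n : ℕ => (1 / 2 : ℝ) • y - (1 / 2 : ℝ) ^ (n + 1) • (r n).1)
        Filter.atTop (nhds ((1 / 2 : ℝ) • y)) := by
      simpa using tendsto_const_nhds.sub h2
    exact tendsto_nhds_unique e1 (by simpa only [Function.comp_def, hT] using e2)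

/-- Baire's theorem applied to the closures of `n • T '' (K ∩ closedBall 0 n)`, which cover `Y`. The
interior ball found is moved to the origin by convexity, and the preceding lemma removes the
closure. -/
theorem exists_ball_subset_image_inter_closedBall {W Y : Type*}
    [NormedAddCommGroup W] [NormedSpace ℝ W] [CompleteSpace W]
    [NormedAddCommGroup Y] [NormedSpace ℝ Y] [CompleteSpace Y] {K : Set W}
    (hc : IsClosed K) (hv : Convex ℝ K) (T : W →L[ℝ] Y)
    (hT : ∀ y, ∃ t : ℝ, 0 < t ∧ ∃ w ∈ K, t • T w = y) :
    ∃ δ > 0, ∃ R : ℝ, Metric.ball (0 : Y) δ ⊆ T '' (K ∩ Metric.closedBall 0 R) := by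
  obtain ⟨t₀, ht₀, w₀, hw₀, e₀⟩ := hT 0
  have hTw₀ : T w₀ = 0 := (smul_eq_zero.1 e₀).resolve_left ht₀.ne'
  have scale : ∀ (N : ℝ) (t : ℝ) (w : W), 0 < N → 0 ≤ t → t ≤ N → ‖w₀‖ ≤ N → w ∈ K → ‖w‖ ≤ N →
      -- Since `T w₀ = 0`, mixing with `w₀` shrinks the image by `t / N ≤ 1` without leaving `K`,
      -- which need not contain `0`.
      N⁻¹ • t • T w ∈ T '' (K ∩ Metric.closedBall 0 N) := by
    intro N t w hN ht htN hw₀N hwK hwN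
    have h1 : t / N ≤ 1 := (div_le_one hN).2 htN
    refine ⟨(t / N) • w + (1 - t / N) • w₀,
      (hv.inter (convex_closedBall 0 N)) ⟨hwK, by simpa using hwN⟩ ⟨hw₀, by simpa using hw₀N⟩
        (by positivity) (by linarith) (by ring), ?_⟩
    rw [map_add, map_smul, map_smul, hTw₀, smul_zero, add_zero, smul_smul]
    congr 1
    ring
  obtain ⟨n, hn⟩ := nonempty_interior_of_iUnion_of_closed
    (f := fun n : ℕ => closure ((n : ℝ) • T '' (K ∩ Metric.closedBall 0 (n : ℝ))))
    (fun n => isClosed_closure) (by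
      refine Set.eq_univ_of_forall fun y => ?_
      obtain ⟨t, ht, w, hw, rfl⟩ := hT y
      obtain ⟨n, hn⟩ := exists_nat_ge (max t (max ‖w‖ ‖w₀‖))
      simp only [max_le_iff] at hn
      have hn0 : (0 : ℝ) < n := ht.trans_le hn.1
      refine Set.mem_iUnion.2 ⟨n, subset_closure ?_⟩
      rw [Set.mem_smul_set_iff_inv_smul_mem₀ hn0.ne']
      exact scale n t w hn0 ht.le hn.1 hn.2.2 hw hn.2.1)
  obtain ⟨y₀, hy₀⟩ := hn
  obtain ⟨ε, hε, hball⟩ := Metric.isOpen_iff.1 isOpen_interior y₀ hy₀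
  obtain ⟨t, ht, w, hw, hty⟩ := hT (-y₀)
  obtain ⟨N, hN⟩ := exists_nat_ge (max (n : ℝ) (max t (max ‖w‖ ‖w₀‖)))
  simp only [max_le_iff] at hN
  have hN0 : (0 : ℝ) < N := ht.trans_le hN.2.1
  have hDv : Convex ℝ (K ∩ Metric.closedBall (0 : W) N) := hv.inter (convex_closedBall 0 _)
  -- `v` is the midpoint of `N⁻¹ (y₀ + 2 N v)` and `N⁻¹ (-y₀)`.
  have hcl : Metric.ball (0 : Y) (ε / (2 * N)) ⊆ closure (T '' (K ∩ Metric.closedBall 0 (N : ℝ))) := by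
    intro v hvb
    have m1 : y₀ + (2 * N : ℝ) • v ∈ closure ((n : ℝ) • T '' (K ∩ Metric.closedBall 0 (n : ℝ))) := by
      refine interior_subset (hball ?_)
      rw [mem_ball_zero_iff, lt_div_iff₀ (by positivity)] at hvb
      rw [Metric.mem_ball, dist_eq_norm, add_sub_cancel_left, norm_smul, Real.norm_eq_abs,
        abs_of_pos (by positivity)]
      linarith
    have m2 : (N : ℝ)⁻¹ • (y₀ + (2 * N : ℝ) • v) ∈
        closure (T '' (K ∩ Metric.closedBall 0 (N : ℝ))) := by
      refine map_mem_closure (continuous_const_smul (N : ℝ)⁻¹) m1 ?_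
      rintro _ ⟨_, ⟨x, ⟨hxK, hx⟩, rfl⟩, rfl⟩
      exact scale N n x hN0 (by positivity) hN.1 hN.2.2.2 hxK
        ((mem_closedBall_zero_iff.1 hx).trans hN.1)
    have m3 : (N : ℝ)⁻¹ • (-y₀) ∈ closure (T '' (K ∩ Metric.closedBall 0 (N : ℝ))) := by
      rw [← hty]
      exact subset_closure (scale N t w hN0 ht.le hN.2.1 hN.2.2.2 hw hN.2.2.1)
    have hTv : Convex ℝ (T '' (K ∩ Metric.closedBall 0 (N : ℝ))) := hDv.linear_image T.toLinearMap
    have m4 := hTv.closure m2 m3 (by norm_num : (0 : ℝ) ≤ 1 / 2)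
      (by norm_num : (0 : ℝ) ≤ 1 / 2) (by norm_num)
    convert m4 using 1
    rw [smul_smul, smul_smul, smul_add, smul_neg, smul_smul]
    have : (1 / 2 * (N : ℝ)⁻¹ * (2 * N)) = 1 := by field_simp
    rw [this, one_smul]
    abel
  have hδ : 0 < ε / (2 * N : ℝ) := by positivity
  refine ⟨ε / (2 * N) / 2, by positivity, N, fun y hy => ?_⟩
  have := half_smul_mem_image_of_ball_subset_closure (hc.inter Metric.isClosed_closedBall) hDv
    (R := N) (fun w hw => mem_closedBall_zero_iff.1 hw.2) T hδ hcl (y := (2 : ℝ) • y) (by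
      rw [mem_ball_zero_iff] at hy ⊢
      rw [norm_smul]
      norm_num
      linarith)
  rwa [smul_smul, (by norm_num : (1 / 2 * 2 : ℝ) = 1), one_smul] at this

/-! ### Lagrange multipliers. -/

/-- Hahn–Banach separates `(0, c)` from the interior of the strict hypograph `S` of the value
function of `l` under `T`. The multiplier is the `Y`-part of the separating functional, normalized
by its real coefficient. -/
theorem exists_multiplier_of_forall_exists_smul {W Y : Type*}
    [NormedAddCommGroup W] [NormedSpace ℝ W] [CompleteSpace W]
    [NormedAddCommGroup Y] [NormedSpace ℝ Y] [CompleteSpace Y] {K : Set W}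
    (hc : IsClosed K) (hv : Convex ℝ K) (T : W →L[ℝ] Y)
    (hT : ∀ y, ∃ t : ℝ, 0 < t ∧ ∃ w ∈ K, t • T w = y)
    (l : StrongDual ℝ W) (c : ℝ) (h : ∀ w ∈ K, T w = 0 → l w ≤ c) :
    ∃ η : StrongDual ℝ Y, ∀ w ∈ K, l w + η (T w) ≤ c := by
  obtain ⟨δ, hδ, R, hR⟩ := exists_ball_subset_image_inter_closedBall hc hv T hT
  let S : Set (Y × ℝ) := {p | ∃ w ∈ K, T w = p.1 ∧ p.2 < l w}
  have hS : Convex ℝ S := by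
    rintro ⟨y, r⟩ ⟨w, hw, hTw, hr⟩ ⟨y', r'⟩ ⟨w', hw', hTw', hr'⟩ a b ha hb hab
    refine ⟨a • w + b • w', hv hw hw' ha hb hab, ?_, ?_⟩
    · simp only at hTw hTw'
      simp [hTw, hTw']
    · simp only [map_add, map_smul, smul_eq_mul, Prod.smul_mk, Prod.mk_add_mk] at *
      rcases ha.eq_or_lt with rfl | ha
      · obtain rfl : b = 1 := by linarith
        simpa using hr'
      · nlinarith [mul_lt_mul_of_pos_left hr ha, mul_le_mul_of_nonneg_left hr'.le hb]
  -- Points near `0` have preimages of norm at most `R`, where `l ≥ -‖l‖ R`; hence `S` has interior.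
  have hopen : Metric.ball (0 : Y) δ ×ˢ Set.Iio (-(‖l‖ * R)) ⊆ interior S := by
    refine interior_maximal ?_ (Metric.isOpen_ball.prod isOpen_Iio)
    rintro ⟨y, r⟩ ⟨hy, hr⟩
    obtain ⟨w, ⟨hwK, hwR⟩, rfl⟩ := hR hy
    refine ⟨w, hwK, rfl, ?_⟩
    have h1 := abs_le.1 (l.le_opNorm w)
    have h2 : ‖l‖ * ‖w‖ ≤ ‖l‖ * R :=
      mul_le_mul_of_nonneg_left (mem_closedBall_zero_iff.1 hwR) (norm_nonneg _)
    simp only [Set.mem_Iio] at hr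
    simp only
    linarith [h1.1]
  have hmem : ((0 : Y), -(‖l‖ * R) - 1) ∈ interior S :=
    hopen ⟨Metric.mem_ball_self hδ, by simp⟩
  obtain ⟨φ, hφ⟩ := geometric_hahn_banach_open_point (x := ((0 : Y), c)) hS.interior
    isOpen_interior (fun hmem => by
      obtain ⟨w, hw, hTw, hlt⟩ := interior_subset hmem
      exact absurd (h w hw hTw) (not_le.2 hlt))
  have hφS : ∀ p ∈ S, φ p ≤ φ (0, c) := by
    intro p hp
    have : p ∈ closure (interior S) := by
      rw [hS.closure_interior_eq_closure_of_nonempty_interior ⟨_, hmem⟩]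
      exact subset_closure hp
    exact closure_minimal (fun a ha => (hφ a ha).le)
      (isClosed_le φ.continuous continuous_const) this
  have hdec : ∀ y r, φ (y, r) = φ (y, 0) + φ (0, 1) * r := by
    intro y r
    have : ((y, r) : Y × ℝ) = (y, 0) + r • (0, 1) := by simp
    rw [this, map_add, map_smul, smul_eq_mul, mul_comm]
  have h00 : φ ((0 : Y), (0 : ℝ)) = 0 := map_zero φ
  -- The hyperplane is not vertical: an interior point of `S` over `0` lies strictly below `(0, c)`.
  have hκ : 0 < φ (0, 1) := by
    obtain ⟨w, hw, hTw, hlt⟩ := interior_subset hmem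
    have h1 := h w hw hTw
    have h2 := hφ _ hmem
    rw [hdec, hdec 0 c] at h2
    simp only at hlt
    by_contra hneg
    nlinarith [mul_nonneg (sub_nonneg.2 (not_lt.1 hneg)) (sub_nonneg.2 (hlt.le.trans h1))]
  refine ⟨(φ (0, 1))⁻¹ • φ.comp (ContinuousLinearMap.inl ℝ Y ℝ), fun w hw => ?_⟩
  have h1 : φ (T w, l w) ≤ φ (0, c) := by
    refine le_of_forall_pos_lt_add fun ε hε => ?_
    have h2 := hφS (T w, l w - ε / 2 / φ (0, 1)) ⟨w, hw, rfl, by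
      simp only; linarith [div_pos (half_pos hε) hκ]⟩
    rw [hdec] at h2 ⊢
    have h3 : φ (0, 1) * (ε / 2 / φ (0, 1)) = ε / 2 := by field_simp
    rw [mul_sub, h3] at h2
    linarith
  rw [hdec, hdec 0 c, h00, zero_add] at h1
  have h4 : (φ (0, 1))⁻¹ * φ (T w, 0) = φ (T w, 0) / φ (0, 1) := by ring
  simp only [smul_apply, ContinuousLinearMap.comp_apply,
    ContinuousLinearMap.inl_apply, smul_eq_mul, h4]
  have h5 : φ (T w, 0) / φ (0, 1) ≤ c - l w := by
    rw [div_le_iff₀ hκ]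
    linarith
  linarith

/-- A Lagrange multiplier theorem of Attouch–Brezis type. -/
theorem exists_multiplier {W Y : Type*}
    [NormedAddCommGroup W] [NormedSpace ℝ W] [CompleteSpace W]
    [NormedAddCommGroup Y] [NormedSpace ℝ Y] [CompleteSpace Y] {K : Set W}
    (hc : IsClosed K) (hv : Convex ℝ K) (T : W →L[ℝ] Y)
    (hT : ConeIsClosedSubspace (T '' K))
    (l : StrongDual ℝ W) (c : ℝ) (h : ∀ w ∈ K, T w = 0 → l w ≤ c) :
    ∃ η : StrongDual ℝ Y, ∀ w ∈ K, l w + η (T w) ≤ c := by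
  obtain ⟨L, hL, hLc⟩ := hT
  have hKL : ∀ w ∈ K, T w ∈ L := by
    intro w hw
    rw [← SetLike.mem_coe, hL]
    simp only [Set.mem_iUnion]
    exact ⟨1, one_pos, T w, ⟨w, hw, rfl⟩, one_smul _ _⟩
  -- Over `T⁻¹ L` the cone condition becomes surjectivity onto the complete space `L`; the
  -- multiplier on `L` is then extended by Hahn–Banach.
  let W₀ : Submodule ℝ W := L.comap T.toLinearMap
  have hW₀c : IsClosed (W₀ : Set W) := hLc.preimage T.continuous
  have : CompleteSpace W₀ := hW₀c.completeSpace_coe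
  have : CompleteSpace L := hLc.completeSpace_coe
  let T₀ : W₀ →L[ℝ] L := (T.comp W₀.subtypeL).codRestrict L fun w => w.2
  obtain ⟨η₀, hη₀⟩ := exists_multiplier_of_forall_exists_smul (K := ((↑) : W₀ → W) ⁻¹' K)
    (hc.preimage continuous_subtype_val) (hv.linear_preimage W₀.subtype) T₀ (by
      rintro ⟨y, hy⟩
      rw [← SetLike.mem_coe, hL] at hy
      simp only [Set.mem_iUnion] at hy
      obtain ⟨t, ht, _, ⟨w, hw, rfl⟩, rfl⟩ := hy
      exact ⟨t, ht, ⟨w, hKL w hw⟩, hw, rfl⟩) (l.comp W₀.subtypeL) c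
    (fun w hw hTw => h w hw (congrArg Subtype.val hTw))
  obtain ⟨η, hη, -⟩ := exists_extension_norm_eq L η₀
  refine ⟨η, fun w hw => ?_⟩
  have h1 := hη₀ ⟨w, hKL w hw⟩ hw
  rw [← hη] at h1
  exact h1

/-! ### Affine minorants, conjugates and linearization. -/

/-- Separation of a point from a convex epigraph by a continuous affine function. -/
theorem exists_affine_minorant {V : Type*} [NormedAddCommGroup V] [NormedSpace ℝ V]
    {G : Set (V × ℝ)} (hv : Convex ℝ G) (hne : G.Nonempty)
    (hup : ∀ z r s, (z, r) ∈ G → r ≤ s → (z, s) ∈ G)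
    {q : V → ℝ} (hq : Continuous q) (hqG : ∀ z r, (z, r) ∈ G → q z ≤ r)
    {z₀ : V} {r₀ : ℝ} (h₀ : (z₀, r₀) ∉ closure G) :
    ∃ (p : StrongDual ℝ V) (c : ℝ), (∀ z r, (z, r) ∈ G → p z - c ≤ r) ∧ r₀ < p z₀ - c := by
  have sep : ∀ z r, (z, r) ∉ closure G → ∃ (p : StrongDual ℝ V) (k u : ℝ), 0 ≤ k ∧
      (∀ z' r', (z', r') ∈ G → u ≤ p z' + k * r') ∧ p z + k * r < u := by
    intro z r hzr
    obtain ⟨φ, u, hlt, hG⟩ := geometric_hahn_banach_point_closed hv.closure isClosed_closure hzr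
    have hdec : ∀ y r, φ (y, r) = φ.comp (ContinuousLinearMap.inl ℝ V ℝ) y + φ (0, 1) * r := by
      intro y r
      have : ((y, r) : V × ℝ) = (y, 0) + r • (0, 1) := by simp
      rw [this, map_add, map_smul, smul_eq_mul, mul_comm]
      simp
    have hG' : ∀ z' r', (z', r') ∈ G → u ≤ φ.comp (ContinuousLinearMap.inl ℝ V ℝ) z'
        + φ (0, 1) * r' := fun z' r' hz' => by
      rw [← hdec]; exact (hG _ (subset_closure hz')).le
    refine ⟨φ.comp (ContinuousLinearMap.inl ℝ V ℝ), φ (0, 1), u, ?_, hG', by rwa [← hdec]⟩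
    -- If the coefficient of `r` were negative, moving up in `G` would violate the bound; the
    -- increment below brings the right-hand side to `u - 1`.
    by_contra! hneg
    obtain ⟨⟨z', r'⟩, hz'⟩ := hne
    set v := φ.comp (ContinuousLinearMap.inl ℝ V ℝ) z' + φ (0, 1) * r' with hvdef
    have huv := hG' z' r' hz'
    have h1 := hG' z' (r' + (v - u + 1) / (-φ (0, 1)))
      (hup _ _ _ hz' (le_add_of_nonneg_right (div_nonneg (by linarith) (by linarith))))
    have h2 : φ (0, 1) * ((v - u + 1) / (-φ (0, 1))) = -(v - u + 1) := by
      have := hneg.ne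
      field_simp
    rw [mul_add, h2] at h1
    linarith
  have conclude : ∀ (p : StrongDual ℝ V) (k u : ℝ), 0 < k →
      (∀ z' r', (z', r') ∈ G → u ≤ p z' + k * r') →
      ∀ z' r', (z', r') ∈ G → (-(k⁻¹ • p)) z' - (-(u / k)) ≤ r' := by
    intro p k u hk hG z' r' hz'
    have h1 := hG z' r' hz'
    simp only [neg_apply, smul_apply, smul_eq_mul]
    have h2 : -(k⁻¹ * p z') - -(u / k) = (u - p z') / k := by field_simp; ring
    rw [h2, div_le_iff₀ hk]
    linarith
  obtain ⟨p, k, u, hk, hG, hlt⟩ := sep z₀ r₀ h₀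
  rcases hk.eq_or_lt with rfl | hk
  -- Vertical hyperplane. The minorant `q` puts `(z₁, q z₁ - 1)` outside the closure, which yields a
  -- non-vertical minorant; a multiple `m` of the vertical functional, large enough to exceed `r₀`
  -- at `z₀`, is added to it.
  · obtain ⟨⟨z₁, r₁⟩, hz₁⟩ := hne
    have hcl : closure G ⊆ {w | q w.1 ≤ w.2} :=
      closure_minimal (fun w hw => hqG w.1 w.2 hw)
        (isClosed_le (hq.comp continuous_fst) continuous_snd)
    obtain ⟨p₁, k₁, u₁, hk₁, hG₁, hlt₁⟩ := sep z₁ (q z₁ - 1) (fun hmem => by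
      have := hcl hmem
      simp only [Set.mem_ofPred_eq] at this
      linarith)
    have hk₁' : 0 < k₁ := by
      refine hk₁.lt_of_ne fun h => ?_
      have := hG₁ _ _ hz₁
      rw [← h] at this hlt₁
      linarith
    have hmin := conclude p₁ k₁ u₁ hk₁' hG₁
    set p₂ : StrongDual ℝ V := -(k₁⁻¹ • p₁) with hp₂
    set c₂ : ℝ := -(u₁ / k₁) with hc₂
    have hpos : 0 < u - p z₀ := by linarith
    set m : ℝ := (|r₀ - (p₂ z₀ - c₂)| + 1) / (u - p z₀) with hm
    have hm0 : 0 ≤ m := by positivity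
    have hmu : m * (u - p z₀) = |r₀ - (p₂ z₀ - c₂)| + 1 := by
      rw [hm]; field_simp
    refine ⟨p₂ - m • p, c₂ - m * u, fun z r hz => ?_, ?_⟩
    · have h1 := hmin z r hz
      have h2 := hG z r hz
      simp only [sub_apply, smul_apply, smul_eq_mul]
      nlinarith [mul_nonneg hm0 (by linarith : 0 ≤ p z - u)]
    · simp only [sub_apply, smul_apply, smul_eq_mul]
      have := le_abs_self (r₀ - (p₂ z₀ - c₂))
      linarith
  · refine ⟨-(k⁻¹ • p), -(u / k), conclude p k u hk hG, ?_⟩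
    simp only [neg_apply, smul_apply, smul_eq_mul]
    have h2 : -(k⁻¹ * p z₀) - -(u / k) = (u - p z₀) / k := by field_simp; ring
    rw [h2, lt_div_iff₀ hk]
    linarith

theorem conj_le_iff {X U : Type*} [NormedAddCommGroup X] [NormedSpace ℝ X]
    [NormedAddCommGroup U] [NormedSpace ℝ U] {f : X × U → EReal}
    {p : StrongDual ℝ X × StrongDual ℝ U} {c : ℝ} :
    conj f p ≤ (c : EReal) ↔ ∀ z (s : ℝ), f z ≤ (s : EReal) → p.1 z.1 + p.2 z.2 - s ≤ c := by
  rw [conj, iSup_le_iff]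
  refine forall_congr' fun z => ⟨fun h s hs => ?_, fun h => ?_⟩
  · have := (EReal.sub_le_sub le_rfl hs).trans h
    exact_mod_cast this
  · induction hz : f z with
    | bot =>
      have := h (p.1 z.1 + p.2 z.2 - c - 1) (by rw [hz]; exact bot_le)
      linarith
    | top => simp
    | coe s => exact_mod_cast h s hz.le

/-- This set is the epigraph of the conjugate; its convexity lets `linearization_le` be used on the
dual side. -/
theorem convex_setOf_affine_minorant {V : Type*} [NormedAddCommGroup V] [NormedSpace ℝ V]
    {U : Type*} [NormedAddCommGroup U] [NormedSpace ℝ U] (G : Set ((V × U) × ℝ)) :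
    Convex ℝ {a : (StrongDual ℝ V × StrongDual ℝ U) × ℝ |
      ∀ z r, (z, r) ∈ G → a.1.1 z.1 + a.1.2 z.2 - r ≤ a.2} := by
  intro a ha a' ha' s t hs ht hst z r hz
  have h1 := mul_le_mul_of_nonneg_left (ha z r hz) hs
  have h2 := mul_le_mul_of_nonneg_left (ha' z r hz) ht
  have h3 : s * r + t * r = r := by rw [← add_mul, hst, one_mul]
  simp only [Prod.fst_add, Prod.snd_add, Prod.smul_fst, Prod.smul_snd, add_apply, smul_apply,
    smul_eq_mul]
  linarith

/-- If a convex set lies above the duality pairing and touches it at `z`, then it lies above the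
linearization of the pairing at `z`. -/
theorem linearization_le {X : Type*} [NormedAddCommGroup X] [NormedSpace ℝ X]
    {G : Set ((X × StrongDual ℝ X) × ℝ)} (hv : Convex ℝ G)
    (hq : ∀ z r, (z, r) ∈ G → z.2 z.1 ≤ r) {z : X × StrongDual ℝ X} (hz : (z, z.2 z.1) ∈ G)
    {w : X × StrongDual ℝ X} {r : ℝ} (hw : (w, r) ∈ G) :
    z.2 w.1 + w.2 z.1 - r ≤ z.2 z.1 := by
  -- The pairing bound at `(1 - t) z + t w`, divided by `t`: the second-order part keeps a factor
  -- `t` and vanishes as `t → 0`.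
  have key : ∀ t : ℝ, 0 < t → t ≤ 1 →
      z.2 w.1 + w.2 z.1 - r - z.2 z.1 ≤ t * (z.2 w.1 + w.2 z.1 - z.2 z.1 - w.2 w.1) := by
    intro t ht ht1
    have h := hq _ _ (hv hz hw (sub_nonneg.2 ht1) ht.le (by ring))
    simp only [Prod.fst_add, Prod.snd_add, Prod.smul_fst, Prod.smul_snd, add_apply, smul_apply,
      smul_eq_mul, map_add, map_smul] at h
    refine le_of_mul_le_mul_left ?_ ht
    linarith
  set m := z.2 w.1 + w.2 z.1 - z.2 z.1 - w.2 w.1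
  have hlim : Filter.Tendsto (fun t : ℝ => t * m) (nhdsWithin 0 (Set.Ioi 0)) (nhds 0) := by
    have : Filter.Tendsto (fun t : ℝ => t * m) (nhds 0) (nhds (0 * m)) :=
      (continuous_id.mul continuous_const).tendsto 0
    rw [zero_mul] at this
    exact this.mono_left nhdsWithin_le_nhds
  have := ge_of_tendsto hlim (b := z.2 w.1 + w.2 z.1 - r - z.2 z.1) (by
    filter_upwards [Ioc_mem_nhdsGT (zero_lt_one' ℝ)] with t ht using key t ht.1 ht.2)
  linarith

theorem continuous_pairing {X : Type*} [NormedAddCommGroup X] [NormedSpace ℝ X] :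
    Continuous fun z : X × StrongDual ℝ X => z.2 z.1 :=
  continuous_snd.clm_apply continuous_fst

theorem IsPCLSC.isClosed_epigraph {X : Type*} [NormedAddCommGroup X] [NormedSpace ℝ X]
    {f : X → EReal} (hf : IsPCLSC f) : IsClosed {p : X × ℝ | f p.1 ≤ (p.2 : EReal)} :=
  hf.lsc.isClosed_epigraph.preimage
    (continuous_fst.prodMk (continuous_coe_real_ereal.comp continuous_snd))

theorem exists_coe_ge {X : Type*} {f : X → EReal} {x : X} (hx : x ∈ effDom f) :
    ∃ r : ℝ, f x ≤ (r : EReal) := by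
  obtain ⟨r, hr, -⟩ := EReal.lt_iff_exists_real_btwn.1 (show f x < ⊤ from hx)
  exact ⟨r, hr.le⟩

theorem mem_effDom_of_le {X : Type*} {f : X → EReal} {x : X} {r : ℝ} (h : f x ≤ (r : EReal)) :
    x ∈ effDom f := h.trans_lt (EReal.coe_lt_top r)

/-- An affine minorant of a set above the pairing, written with a pair of functionals. -/
theorem exists_affine_minorant_of_pairing_le {E : Type*} [NormedAddCommGroup E] [NormedSpace ℝ E]
    {G : Set ((E × StrongDual ℝ E) × ℝ)} (hv : Convex ℝ G) (hne : G.Nonempty)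
    (hup : ∀ z r s, (z, r) ∈ G → r ≤ s → (z, s) ∈ G)
    (hq : ∀ z r, (z, r) ∈ G → z.2 z.1 ≤ r)
    {z₀ : E × StrongDual ℝ E} {r₀ : ℝ} (h₀ : (z₀, r₀) ∉ closure G) :
    ∃ (p : StrongDual ℝ E × StrongDual ℝ (StrongDual ℝ E)) (c : ℝ),
      (∀ z r, (z, r) ∈ G → p.1 z.1 + p.2 z.2 - r ≤ c) ∧ r₀ < p.1 z₀.1 + p.2 z₀.2 - c := by
  obtain ⟨p, c, hp, hlt⟩ := exists_affine_minorant hv hne hup continuous_pairing hq h₀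
  have hdec : ∀ z : E × StrongDual ℝ E, p.comp (ContinuousLinearMap.inl ℝ E (StrongDual ℝ E)) z.1
      + p.comp (ContinuousLinearMap.inr ℝ E (StrongDual ℝ E)) z.2 = p z := by
    intro z
    simp [← map_add]
  refine ⟨(p.comp (ContinuousLinearMap.inl ℝ E _), p.comp (ContinuousLinearMap.inr ℝ E _)), c,
    fun z r hz => ?_, ?_⟩
  · rw [hdec]
    linarith [hp z r hz]
  · rw [hdec]
    exact hlt

/-! ### Strongly representative functions. -/

/-- Forward, linearize on the epigraph of `f`. Conversely, if `f` exceeded the pairing at `(x, x')`,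
some affine minorant would too, against linearization on the epigraph of the conjugate at `(x',
x̂)`. -/
theorem IsStronglyRepresentative.mem_M_iff {E : Type*} [NormedAddCommGroup E] [NormedSpace ℝ E]
    {f : E × StrongDual ℝ E → EReal} (hf : IsStronglyRepresentative f)
    (x : E) (x' : StrongDual ℝ E) :
    x' ∈ M f x ↔ NormedSpace.inclusionInDoubleDual ℝ E x ∈ M (conj f) x' := by
  let G : Set ((E × StrongDual ℝ E) × ℝ) := {p | f p.1 ≤ (p.2 : EReal)}
  have hqG : ∀ z r, (z, r) ∈ G → z.2 z.1 ≤ r := fun z r hz =>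
    EReal.coe_le_coe_iff.1 ((hf.representative.pairing_le z.1 z.2).trans hz)
  constructor
  · intro h
    refine le_antisymm ?_ (hf.pairing_le_conj x' _)
    rw [conj_le_iff]
    intro w s hs
    have h1 := linearization_le hf.representative.pclsc.convex_epigraph hqG (z := (x, x')) (w := w)
      (r := s) (le_of_eq h) hs
    simpa [NormedSpace.dual_def] using h1
  · intro h
    refine le_antisymm ?_ (hf.representative.pairing_le x x')
    by_contra hlt
    have hnot : ((x, x'), x' x) ∉ closure G := by
      rw [hf.representative.pclsc.isClosed_epigraph.closure_eq]
      exact hlt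
    obtain ⟨w, hw⟩ := hf.representative.pclsc.dom_nonempty
    obtain ⟨s, hs⟩ := exists_coe_ge hw
    obtain ⟨p, c, hp, hpc⟩ := exists_affine_minorant_of_pairing_le
      hf.representative.pclsc.convex_epigraph ⟨(w, s), hs⟩
      (fun z r s hz hrs => le_trans hz (EReal.coe_le_coe_iff.2 hrs)) hqG hnot
    have h1 := linearization_le (convex_setOf_affine_minorant G)
      (fun p c hpc => EReal.coe_le_coe_iff.1 ((hf.pairing_le_conj p.1 p.2).trans
        (conj_le_iff.2 hpc)))
      (z := (x', NormedSpace.inclusionInDoubleDual ℝ E x)) (conj_le_iff.1 (le_of_eq h))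
      (w := p) (r := c) hp
    simp only [NormedSpace.dual_def] at h1
    simp only at hpc
    linarith

/-- The lower semicontinuous hull of a convex set above the pairing whose support function
is above the pairing of the duals is strongly representative. -/
theorem exists_isStronglyRepresentative {E : Type*} [NormedAddCommGroup E] [NormedSpace ℝ E]
    {G : Set ((E × StrongDual ℝ E) × ℝ)} (hv : Convex ℝ G) (hne : G.Nonempty)
    (hup : ∀ z r s, (z, r) ∈ G → r ≤ s → (z, s) ∈ G)
    (hq : ∀ z r, (z, r) ∈ G → z.2 z.1 ≤ r)
    (hconj : ∀ (p : StrongDual ℝ E × StrongDual ℝ (StrongDual ℝ E)) (c : ℝ),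
      (∀ z r, (z, r) ∈ G → p.1 z.1 + p.2 z.2 - r ≤ c) → p.2 p.1 ≤ c) :
    ∃ k : E × StrongDual ℝ E → EReal, IsStronglyRepresentative k ∧
      ∀ x x', x' ∈ M k x ↔ ∀ w r, (w, r) ∈ G → x' w.1 + w.2 x - r ≤ x' x := by
  let A : Set ((StrongDual ℝ E × StrongDual ℝ (StrongDual ℝ E)) × ℝ) :=
    {a | ∀ z r, (z, r) ∈ G → a.1.1 z.1 + a.1.2 z.2 - r ≤ a.2}
  have hA : Convex ℝ A := convex_setOf_affine_minorant G
  -- `k` is the supremum of the affine minorants of `G`, that is, the biconjugate restricted to `E ×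
  -- E*`.
  let k : E × StrongDual ℝ E → EReal :=
    fun z => ⨆ a : A, ((a.1.1.1 z.1 + a.1.1.2 z.2 - a.1.2 : ℝ) : EReal)
  have hk : ∀ z (r : ℝ), k z ≤ (r : EReal) ↔
      ∀ a ∈ A, a.1.1 z.1 + a.1.2 z.2 - a.2 ≤ r := by
    intro z r
    simp only [k, iSup_le_iff, Subtype.forall, EReal.coe_le_coe_iff]
  have hkG : ∀ z r, (z, r) ∈ G → k z ≤ (r : EReal) := by
    intro z r hz
    rw [hk]
    intro a ha
    linarith [ha z r hz]
  have hkq : ∀ (x : E) (x' : StrongDual ℝ E), ((x' x : ℝ) : EReal) ≤ k (x, x') := by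
    intro x x'
    by_contra! hlt
    obtain ⟨r, hr, hrq⟩ := EReal.lt_iff_exists_real_btwn.1 hlt
    have hcl : closure G ⊆ {w | w.1.2 w.1.1 ≤ w.2} :=
      closure_minimal (fun w hw => hq w.1 w.2 hw)
        (isClosed_le (continuous_pairing.comp continuous_fst) continuous_snd)
    obtain ⟨p, c, hp, hpc⟩ := exists_affine_minorant_of_pairing_le hv hne hup hq
      (z₀ := (x, x')) (r₀ := r) (fun hmem => by
        have h1 := hcl hmem
        simp only [Set.mem_ofPred_eq] at h1
        exact absurd (EReal.coe_lt_coe_iff.1 hrq) (not_lt.2 h1))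
    have := (hk _ _).1 hr.le (p, c) hp
    exact absurd hpc (not_lt.2 this)
  have hkv : Convex ℝ {p : (E × StrongDual ℝ E) × ℝ | k p.1 ≤ (p.2 : EReal)} := by
    intro p hp p' hp' s t hs ht hst
    simp only [Set.mem_ofPred_eq, hk] at hp hp' ⊢
    intro a ha
    have h1 := mul_le_mul_of_nonneg_left (hp a ha) hs
    have h2 := mul_le_mul_of_nonneg_left (hp' a ha) ht
    have h3 : s * a.2 + t * a.2 = a.2 := by rw [← add_mul, hst, one_mul]
    simp only [Prod.fst_add, Prod.snd_add, Prod.smul_fst, Prod.smul_snd, map_add, map_smul,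
      smul_eq_mul]
    linarith
  obtain ⟨⟨w, s⟩, hws⟩ := hne
  refine ⟨k, ⟨⟨⟨fun z hz => ?_, ⟨w, mem_effDom_of_le (hkG w s hws)⟩, hkv, ?_⟩, hkq⟩, ?_⟩, ?_⟩
  · have := hkq z.1 z.2
    rw [hz] at this
    exact absurd this (not_le.2 (EReal.bot_lt_coe _))
  · refine lowerSemicontinuous_iSup fun a => Continuous.lowerSemicontinuous ?_
    refine continuous_coe_real_ereal.comp ?_
    fun_prop
  · intro x' x''
    by_contra! hlt
    obtain ⟨c, hc, hcq⟩ := EReal.lt_iff_exists_real_btwn.1 hlt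
    have h1 := hconj (x', x'') c fun z r hz => conj_le_iff.1 hc.le z r (hkG z r hz)
    exact absurd (EReal.coe_lt_coe_iff.1 hcq) (not_lt.2 h1)
  · intro x x'
    constructor
    · intro h w r hwr
      exact linearization_le hkv
        (fun z r hz => EReal.coe_le_coe_iff.1 ((hkq z.1 z.2).trans hz)) (z := (x, x'))
        (le_of_eq h) (hkG w r hwr)
    · intro h
      refine le_antisymm ?_ (hkq x x')
      rw [hk]
      rintro ⟨p, c⟩ hp
      -- The hypothesis says that the conjugate touches the dual pairing at `(x', x̂)`; linearizing
      -- there bounds every affine minorant at `(x, x')`.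
      have h1 := linearization_le hA (fun p c hp => hconj p c hp)
        (z := (x', NormedSpace.inclusionInDoubleDual ℝ E x)) (w := p) (r := c)
        (fun z r hz => by simpa [NormedSpace.dual_def] using h z r hz) hp
      simp only [NormedSpace.dual_def] at h1
      simp only
      linarith

/-! ### The marginal construction. -/

/-- If `s₁ + s₂ ≤ c` on two nonempty sets, then `c` splits accordingly. -/
theorem exists_split {S₁ S₂ : Set ℝ} (h₁ : S₁.Nonempty) (h₂ : S₂.Nonempty) {c : ℝ}
    (h : ∀ a ∈ S₁, ∀ b ∈ S₂, a + b ≤ c) :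
    ∃ r, (∀ a ∈ S₁, a ≤ r) ∧ ∀ b ∈ S₂, b ≤ c - r := by
  obtain ⟨b₀, hb₀⟩ := h₂
  refine ⟨sSup S₁, fun a ha => le_csSup ⟨c - b₀, fun a ha => by linarith [h a ha b₀ hb₀]⟩ ha,
    fun b hb => ?_⟩
  have := csSup_le (a := c - b) h₁ fun a ha => by linarith [h a ha b hb]
  linarith

/-- The general construction: the marginal of `f ⊕ g` along `P` on the kernel of `T`. -/
theorem exists_isStronglyRepresentative_marginal
    {E : Type*} [NormedAddCommGroup E] [NormedSpace ℝ E] [CompleteSpace E]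
    {F : Type*} [NormedAddCommGroup F] [NormedSpace ℝ F] [CompleteSpace F]
    {Y : Type*} [NormedAddCommGroup Y] [NormedSpace ℝ Y] [CompleteSpace Y]
    {f : E × StrongDual ℝ E → EReal} {g : F × StrongDual ℝ F → EReal}
    (hf : IsStronglyRepresentative f) (hg : IsStronglyRepresentative g)
    (T : (E × StrongDual ℝ E) × (F × StrongDual ℝ F) →L[ℝ] Y)
    (P : (E × StrongDual ℝ E) × (F × StrongDual ℝ F) →L[ℝ] E × StrongDual ℝ E)
    (α : StrongDual ℝ E × StrongDual ℝ (StrongDual ℝ E) → StrongDual ℝ Y →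
      StrongDual ℝ E × StrongDual ℝ (StrongDual ℝ E))
    (β : StrongDual ℝ E × StrongDual ℝ (StrongDual ℝ E) → StrongDual ℝ Y →
      StrongDual ℝ F × StrongDual ℝ (StrongDual ℝ F))
    (hP : ∀ z w, T (z, w) = 0 → (P (z, w)).2 (P (z, w)).1 = z.2 z.1 + w.2 w.1)
    (hαβ : ∀ p η z w, p.1 (P (z, w)).1 + p.2 (P (z, w)).2 + η (T (z, w)) =
      (α p η).1 z.1 + (α p η).2 z.2 + ((β p η).1 w.1 + (β p η).2 w.2))
    (hq : ∀ p η, (α p η).2 (α p η).1 + (β p η).2 (β p η).1 = p.2 p.1)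
    (hcone : ConeIsClosedSubspace (T '' effDom f ×ˢ effDom g)) :
    ∃ k : E × StrongDual ℝ E → EReal, IsStronglyRepresentative k ∧
      ∀ x x', x' ∈ M k x ↔ ∃ η,
        (α (x', NormedSpace.inclusionInDoubleDual ℝ E x) η).2 ∈
          M (conj f) (α (x', NormedSpace.inclusionInDoubleDual ℝ E x) η).1 ∧
        (β (x', NormedSpace.inclusionInDoubleDual ℝ E x) η).2 ∈
          M (conj g) (β (x', NormedSpace.inclusionInDoubleDual ℝ E x) η).1 := by
  let G : Set ((E × StrongDual ℝ E) × ℝ) := {p | ∃ z w, ∃ a b : ℝ, T (z, w) = 0 ∧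
    P (z, w) = p.1 ∧ f z ≤ (a : EReal) ∧ g w ≤ (b : EReal) ∧ a + b ≤ p.2}
  have hfq : ∀ (z) (a : ℝ), f z ≤ (a : EReal) → z.2 z.1 ≤ a := fun z a hz =>
    EReal.coe_le_coe_iff.1 ((hf.representative.pairing_le z.1 z.2).trans hz)
  have hgq : ∀ (z) (a : ℝ), g z ≤ (a : EReal) → z.2 z.1 ≤ a := fun z a hz =>
    EReal.coe_le_coe_iff.1 ((hg.representative.pairing_le z.1 z.2).trans hz)
  have hGv : Convex ℝ G := by
    rintro ⟨p, r⟩ ⟨z, w, a, b, hT, hp, hz, hw, hab⟩ ⟨p', r'⟩ ⟨z', w', a', b', hT', hp', hz', hw', hab'⟩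
      s t hs ht hst
    refine ⟨s • z + t • z', s • w + t • w', s * a + t * a', s * b + t * b', ?_, ?_,
      hf.representative.pclsc.convex_epigraph (x := (z, a)) hz (y := (z', a')) hz' hs ht hst,
      hg.representative.pclsc.convex_epigraph (x := (w, b)) hw (y := (w', b')) hw' hs ht hst, ?_⟩
    · rw [← Prod.mk_add_mk, ← Prod.smul_mk, ← Prod.smul_mk, map_add, map_smul, map_smul, hT, hT']
      simp
    · rw [← Prod.mk_add_mk, ← Prod.smul_mk, ← Prod.smul_mk, map_add, map_smul, map_smul, hp, hp']
      simp
    · have h1 := mul_le_mul_of_nonneg_left hab hs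
      have h2 := mul_le_mul_of_nonneg_left hab' ht
      simp only [Prod.snd_add, Prod.smul_snd, smul_eq_mul] at h1 h2 ⊢
      linarith
  -- A subspace contains `0`, so the cone condition supplies a feasible pair.
  have hGne : G.Nonempty := by
    obtain ⟨L, hL, -⟩ := hcone
    have h0 : (0 : Y) ∈ (L : Set Y) := L.zero_mem
    rw [hL] at h0
    simp only [Set.mem_iUnion] at h0
    obtain ⟨t, ht, _, ⟨⟨z, w⟩, ⟨hz, hw⟩, rfl⟩, h0⟩ := h0
    obtain ⟨a, ha⟩ := exists_coe_ge hz
    obtain ⟨b, hb⟩ := exists_coe_ge hw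
    exact ⟨(P (z, w), a + b), z, w, a, b, (smul_eq_zero.1 h0).resolve_left ht.ne', rfl, ha, hb,
      le_rfl⟩
  have hGup : ∀ z r s, (z, r) ∈ G → r ≤ s → (z, s) ∈ G := by
    rintro p r s ⟨z, w, a, b, hT, hp, hz, hw, hab⟩ hrs
    exact ⟨z, w, a, b, hT, hp, hz, hw, hab.trans hrs⟩
  have hGq : ∀ z r, (z, r) ∈ G → z.2 z.1 ≤ r := by
    rintro _ r ⟨z, w, a, b, hT, rfl, hz, hw, hab⟩
    simp only at hab ⊢
    rw [hP z w hT]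
    linarith [hfq z a hz, hgq w b hw]
  -- Exactness of the conjugate: by `hαβ`, adding `η ∘ T` to `p ∘ P` separates the variables into `α
  -- p η` and `β p η`.
  have hsplit : ∀ (p : StrongDual ℝ E × StrongDual ℝ (StrongDual ℝ E)) (c : ℝ),
      (∀ z r, (z, r) ∈ G → p.1 z.1 + p.2 z.2 - r ≤ c) →
      ∃ η, ∃ r : ℝ, conj f (α p η) ≤ (r : EReal) ∧ conj g (β p η) ≤ ((c - r : ℝ) : EReal) := by
    intro p c hpc
    let W := ((E × StrongDual ℝ E) × ℝ) × ((F × StrongDual ℝ F) × ℝ)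
    -- With the epigraph heights as extra variables, the objective is a continuous linear functional
    -- on a closed convex set.
    let K : Set W := {u | f u.1.1 ≤ (u.1.2 : EReal)} ∩ {u | g u.2.1 ≤ (u.2.2 : EReal)}
    have hKc : IsClosed K :=
      (hf.representative.pclsc.isClosed_epigraph.preimage continuous_fst).inter
        (hg.representative.pclsc.isClosed_epigraph.preimage continuous_snd)
    have hKv : Convex ℝ K :=
      (hf.representative.pclsc.convex_epigraph.linear_preimage
        (LinearMap.fst ℝ ((E × StrongDual ℝ E) × ℝ) ((F × StrongDual ℝ F) × ℝ))).inter
      (hg.representative.pclsc.convex_epigraph.linear_preimage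
        (LinearMap.snd ℝ ((E × StrongDual ℝ E) × ℝ) ((F × StrongDual ℝ F) × ℝ)))
    let e₁ := ContinuousLinearMap.fst ℝ ((E × StrongDual ℝ E) × ℝ) ((F × StrongDual ℝ F) × ℝ)
    let e₂ := ContinuousLinearMap.snd ℝ ((E × StrongDual ℝ E) × ℝ) ((F × StrongDual ℝ F) × ℝ)
    let Q : W →L[ℝ] (E × StrongDual ℝ E) × (F × StrongDual ℝ F) :=
      ((ContinuousLinearMap.fst ℝ _ _).comp e₁).prod ((ContinuousLinearMap.fst ℝ _ _).comp e₂)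
    have himage : (T.comp Q) '' K = T '' effDom f ×ˢ effDom g := by
      ext y
      constructor
      · rintro ⟨⟨⟨z, a⟩, ⟨w, b⟩⟩, ⟨hz, hw⟩, rfl⟩
        exact ⟨(z, w), ⟨mem_effDom_of_le hz, mem_effDom_of_le hw⟩, rfl⟩
      · rintro ⟨⟨z, w⟩, ⟨hz, hw⟩, rfl⟩
        obtain ⟨a, ha⟩ := exists_coe_ge hz
        obtain ⟨b, hb⟩ := exists_coe_ge hw
        exact ⟨((z, a), (w, b)), ⟨ha, hb⟩, rfl⟩
    obtain ⟨η, hη⟩ := exists_multiplier hKc hKv (T.comp Q) (by rwa [himage])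
      ((p.1.coprod p.2).comp (P.comp Q) - (ContinuousLinearMap.snd ℝ _ _).comp e₁
        - (ContinuousLinearMap.snd ℝ _ _).comp e₂) c (by
        rintro ⟨⟨z, a⟩, ⟨w, b⟩⟩ ⟨hz, hw⟩ hT
        have h1 := hpc (P (z, w)) (a + b) ⟨z, w, a, b, hT, rfl, hz, hw, le_rfl⟩
        simp only [sub_apply, ContinuousLinearMap.comp_apply, ContinuousLinearMap.coprod_apply]
        change p.1 (P (z, w)).1 + p.2 (P (z, w)).2 - a - b ≤ c
        linarith)
    have hη' : ∀ z w (a b : ℝ), f z ≤ (a : EReal) → g w ≤ (b : EReal) →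
        ((α p η).1 z.1 + (α p η).2 z.2 - a) + ((β p η).1 w.1 + (β p η).2 w.2 - b) ≤ c := by
      intro z w a b hz hw
      have h1 : p.1 (P (z, w)).1 + p.2 (P (z, w)).2 - a - b + η (T (z, w)) ≤ c :=
        hη ((z, a), (w, b)) ⟨hz, hw⟩
      linarith [hαβ p η z w]
    obtain ⟨z, hz⟩ := hf.representative.pclsc.dom_nonempty
    obtain ⟨a, ha⟩ := exists_coe_ge hz
    obtain ⟨w, hw⟩ := hg.representative.pclsc.dom_nonempty
    obtain ⟨b, hb⟩ := exists_coe_ge hw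
    obtain ⟨r, hr₁, hr₂⟩ := exists_split
      (S₁ := {v | ∃ z, ∃ a : ℝ, f z ≤ (a : EReal) ∧ (α p η).1 z.1 + (α p η).2 z.2 - a = v})
      (S₂ := {v | ∃ w, ∃ b : ℝ, g w ≤ (b : EReal) ∧ (β p η).1 w.1 + (β p η).2 w.2 - b = v})
      ⟨_, z, a, ha, rfl⟩ ⟨_, w, b, hb, rfl⟩ (c := c) (by
        rintro _ ⟨z, a, hz, rfl⟩ _ ⟨w, b, hw, rfl⟩
        exact hη' z w a b hz hw)
    exact ⟨η, r, conj_le_iff.2 fun z a hz => hr₁ _ ⟨z, a, hz, rfl⟩,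
      conj_le_iff.2 fun w b hw => hr₂ _ ⟨w, b, hw, rfl⟩⟩
  obtain ⟨k, hk, hkM⟩ := exists_isStronglyRepresentative hGv hGne hGup hGq (by
    intro p c hpc
    obtain ⟨η, r, h1, h2⟩ := hsplit p c hpc
    have h3 := EReal.coe_le_coe_iff.1 ((hf.pairing_le_conj _ _).trans h1)
    have h4 := EReal.coe_le_coe_iff.1 ((hg.pairing_le_conj _ _).trans h2)
    linarith [hq p η])
  refine ⟨k, hk, fun x x' => ?_⟩
  rw [hkM]
  set p : StrongDual ℝ E × StrongDual ℝ (StrongDual ℝ E) :=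
    (x', NormedSpace.inclusionInDoubleDual ℝ E x) with hp
  have hpq : p.2 p.1 = x' x := rfl
  constructor
  · intro h
    obtain ⟨η, r, h1, h2⟩ := hsplit p (x' x) fun z r hz => h z r hz
    have h3 := EReal.coe_le_coe_iff.1 ((hf.pairing_le_conj _ _).trans h1)
    have h4 := EReal.coe_le_coe_iff.1 ((hg.pairing_le_conj _ _).trans h2)
    have h5 := hq p η
    -- The two upper bounds sum to `x' x`, which by `hq` is the sum of the two pairings bounding the
    -- conjugates below; so equality holds in each.
    refine ⟨η, le_antisymm (h1.trans (EReal.coe_le_coe_iff.2 ?_)) (hf.pairing_le_conj _ _),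
      le_antisymm (h2.trans (EReal.coe_le_coe_iff.2 ?_)) (hg.pairing_le_conj _ _)⟩ <;> linarith
  · rintro ⟨η, h1, h2⟩ _ r ⟨z, w, a, b, hT, rfl, hz, hw, hab⟩
    have h3 := conj_le_iff.1 (le_of_eq h1) z a hz
    have h4 := conj_le_iff.1 (le_of_eq h2) w b hw
    have h5 := hαβ p η z w
    have h6 : p.1 (P (z, w)).1 + p.2 (P (z, w)).2
      = x' (P (z, w)).1 + (P (z, w)).2 x := rfl
    have h7 := hq p η
    rw [hT, map_zero] at h5
    simp only at h3 h4 hab ⊢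
    linarith

/-! ### The two marginals and the theorem. -/

/-- Constraint `y = A x`, output `(x, x* + Aᵀ y*)`. The multiplier lies in `F*` and serves as the
element of `M g (A x)`. -/
theorem exists_isStronglyRepresentative_add_comp
    {E : Type*} [NormedAddCommGroup E] [NormedSpace ℝ E] [CompleteSpace E]
    {F : Type*} [NormedAddCommGroup F] [NormedSpace ℝ F] [CompleteSpace F]
    {f : E × StrongDual ℝ E → EReal} {g : F × StrongDual ℝ F → EReal}
    (hf : IsStronglyRepresentative f) (hg : IsStronglyRepresentative g) (A : E →L[ℝ] F)
    (hcone : ConeIsClosedSubspace (Prod.fst '' effDom g - A '' (Prod.fst '' effDom f))) :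
    ∃ k : E × StrongDual ℝ E → EReal, IsStronglyRepresentative k ∧
      ∀ x x', x' ∈ M k x ↔ ∃ η : StrongDual ℝ F,
        NormedSpace.inclusionInDoubleDual ℝ E x ∈ M (conj f) (x' - adj A η) ∧
        NormedSpace.inclusionInDoubleDual ℝ F (A x) ∈ M (conj g) η := by
  let i₁ := ContinuousLinearMap.fst ℝ (E × StrongDual ℝ E) (F × StrongDual ℝ F)
  let i₂ := ContinuousLinearMap.snd ℝ (E × StrongDual ℝ E) (F × StrongDual ℝ F)
  let T : (E × StrongDual ℝ E) × (F × StrongDual ℝ F) →L[ℝ] F :=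
    (ContinuousLinearMap.fst ℝ _ _).comp i₂ - A.comp ((ContinuousLinearMap.fst ℝ _ _).comp i₁)
  let P : (E × StrongDual ℝ E) × (F × StrongDual ℝ F) →L[ℝ] E × StrongDual ℝ E :=
    ((ContinuousLinearMap.fst ℝ _ _).comp i₁).prod
      ((ContinuousLinearMap.snd ℝ _ _).comp i₁
        + (adj A).comp ((ContinuousLinearMap.snd ℝ _ _).comp i₂))
  have hT : ∀ z w, T (z, w) = w.1 - A z.1 := fun z w => rfl
  have hP : ∀ z w, P (z, w) = (z.1, z.2 + adj A w.2) := fun z w => rfl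
  refine exists_isStronglyRepresentative_marginal hf hg T P
    (fun p η => (p.1 - adj A η, p.2)) (fun p η => (η, adj (adj A) p.2)) ?_ ?_ ?_ ?_
  · intro z w h
    rw [hT, sub_eq_zero] at h
    rw [hP, h]
    rfl
  · intro p η z w
    rw [hT, hP]
    simp only [map_add, map_sub, sub_apply]
    change _ = p.1 z.1 - η (A z.1) + _ + (_ + p.2 (adj A w.2))
    ring
  · intro p η
    simp only [map_sub]
    change p.2 p.1 - p.2 (adj A η) + p.2 (adj A η) = _
    ring
  · convert hcone using 1
    ext y
    simp only [Set.mem_image, Set.mem_prod, Set.mem_sub]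
    constructor
    · rintro ⟨⟨z, w⟩, ⟨hz, hw⟩, rfl⟩
      exact ⟨w.1, ⟨w, hw, rfl⟩, A z.1, ⟨z.1, ⟨z, hz, rfl⟩, rfl⟩, rfl⟩
    · rintro ⟨_, ⟨w, hw, rfl⟩, _, ⟨_, ⟨z, hz, rfl⟩, rfl⟩, rfl⟩
      exact ⟨(z, w), ⟨hz, hw⟩, rfl⟩

/-- Constraint `y* = Bᵀ x*`, output `(x + B y, x*)`. The multiplier now lies in `F**`, which is why
biduals appear in (b). -/
theorem exists_isStronglyRepresentative_parallel_sum
    {E : Type*} [NormedAddCommGroup E] [NormedSpace ℝ E] [CompleteSpace E]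
    {F : Type*} [NormedAddCommGroup F] [NormedSpace ℝ F] [CompleteSpace F]
    {f : E × StrongDual ℝ E → EReal} {g : F × StrongDual ℝ F → EReal}
    (hf : IsStronglyRepresentative f) (hg : IsStronglyRepresentative g) (B : F →L[ℝ] E)
    (hcone : ConeIsClosedSubspace
      (Prod.snd '' effDom g - adj B '' (Prod.snd '' effDom f))) :
    ∃ k : E × StrongDual ℝ E → EReal, IsStronglyRepresentative k ∧
      ∀ x x', x' ∈ M k x ↔ ∃ η : StrongDual ℝ (StrongDual ℝ F),
        NormedSpace.inclusionInDoubleDual ℝ E x - adj (adj B) η ∈ M (conj f) x' ∧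
        η ∈ M (conj g) (adj B x') := by
  let i₁ := ContinuousLinearMap.fst ℝ (E × StrongDual ℝ E) (F × StrongDual ℝ F)
  let i₂ := ContinuousLinearMap.snd ℝ (E × StrongDual ℝ E) (F × StrongDual ℝ F)
  let T : (E × StrongDual ℝ E) × (F × StrongDual ℝ F) →L[ℝ] StrongDual ℝ F :=
    (ContinuousLinearMap.snd ℝ _ _).comp i₂
      - (adj B).comp ((ContinuousLinearMap.snd ℝ _ _).comp i₁)
  let P : (E × StrongDual ℝ E) × (F × StrongDual ℝ F) →L[ℝ] E × StrongDual ℝ E :=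
    ((ContinuousLinearMap.fst ℝ _ _).comp i₁
      + B.comp ((ContinuousLinearMap.fst ℝ _ _).comp i₂)).prod
      ((ContinuousLinearMap.snd ℝ _ _).comp i₁)
  have hT : ∀ z w, T (z, w) = w.2 - adj B z.2 := fun z w => rfl
  have hP : ∀ z w, P (z, w) = (z.1 + B w.1, z.2) := fun z w => rfl
  refine exists_isStronglyRepresentative_marginal hf hg T P
    (fun p η => (p.1, p.2 - adj (adj B) η)) (fun p η => (adj B p.1, η)) ?_ ?_ ?_ ?_
  · intro z w h
    rw [hT, sub_eq_zero] at h
    rw [hP, h]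
    exact map_add z.2 _ _
  · intro p η z w
    rw [hT, hP]
    simp only [map_add, map_sub, sub_apply]
    change _ = _ + (_ - η (adj B z.2)) + (p.1 (B w.1) + _)
    ring
  · intro p η
    simp only [sub_apply]
    change p.2 p.1 - η (adj B p.1) + η (adj B p.1) = _
    ring
  · convert hcone using 1
    ext y
    simp only [Set.mem_image, Set.mem_prod, Set.mem_sub]
    constructor
    · rintro ⟨⟨z, w⟩, ⟨hz, hw⟩, rfl⟩
      exact ⟨w.2, ⟨w, hw, rfl⟩, adj B z.2, ⟨z.2, ⟨z, hz, rfl⟩, rfl⟩, rfl⟩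
    · rintro ⟨_, ⟨w, hw, rfl⟩, _, ⟨_, ⟨z, hz, rfl⟩, rfl⟩, rfl⟩
      exact ⟨(z, w), ⟨hz, hw⟩, rfl⟩

end StrongRep

theorem theorem15
    {E : Type*} [NormedAddCommGroup E] [NormedSpace ℝ E] [CompleteSpace E] [Nontrivial E]
    {F : Type*} [NormedAddCommGroup F] [NormedSpace ℝ F] [CompleteSpace F] [Nontrivial F]
    (f : E × StrongDual ℝ E → EReal) (g : F × StrongDual ℝ F → EReal)
    (hf : StrongRep.IsStronglyRepresentative f) (hg : StrongRep.IsStronglyRepresentative g) :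
    (∀ A : E →L[ℝ] F,
      StrongRep.ConeIsClosedSubspace
        (Prod.fst '' StrongRep.effDom g - A '' (Prod.fst '' StrongRep.effDom f)) →
      StrongRep.IsStronglyRepresentable
        (fun x : E => StrongRep.M f x + StrongRep.adj A '' StrongRep.M g (A x))) ∧
    (∀ B : F →L[ℝ] E,
      StrongRep.ConeIsClosedSubspace
        (Prod.snd '' StrongRep.effDom g
          - StrongRep.adj B '' (Prod.snd '' StrongRep.effDom f)) →
      StrongRep.IsStronglyRepresentable
        (fun x : E => StrongRep.mInv
          (fun x' : StrongDual ℝ E => StrongRep.M (StrongRep.conj f) x'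
            + StrongRep.adj (StrongRep.adj B) ''
                StrongRep.M (StrongRep.conj g) (StrongRep.adj B x'))
          (NormedSpace.inclusionInDoubleDual ℝ E x))) ∧
    (∀ B : F →L[ℝ] E,
      StrongRep.ConeIsClosedSubspace
        (Prod.snd '' StrongRep.effDom g
          - StrongRep.adj B '' (Prod.snd '' StrongRep.effDom f)) →
      StrongRep.mRange (StrongRep.M (StrongRep.conj g)) ⊆
        Set.range (NormedSpace.inclusionInDoubleDual ℝ F) →
      StrongRep.IsStronglyRepresentable
        (StrongRep.mInv
          (fun x' : StrongDual ℝ E => StrongRep.mInv (StrongRep.M f) x'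
            + B '' StrongRep.mInv (StrongRep.M g) (StrongRep.adj B x')))) := by
  refine ⟨fun A hA => ?_, fun B hB => ?_, fun B hB hR => ?_⟩
  · obtain ⟨k, hk, hkM⟩ :=
      StrongRep.exists_isStronglyRepresentative_add_comp hf hg A hA
    refine ⟨k, hk, ?_⟩
    ext x x'
    simp only [hkM, ← hf.mem_M_iff, ← hg.mem_M_iff, Set.mem_add, Set.mem_image]
    constructor
    · rintro ⟨η, h1, h2⟩
      exact ⟨_, h1, _, ⟨η, h2, rfl⟩, sub_add_cancel _ _⟩
    · rintro ⟨y, h1, _, ⟨η, h2, rfl⟩, rfl⟩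
      exact ⟨η, by rwa [add_sub_cancel_right], h2⟩
  · obtain ⟨k, hk, hkM⟩ :=
      StrongRep.exists_isStronglyRepresentative_parallel_sum hf hg B hB
    refine ⟨k, hk, ?_⟩
    ext x x'
    simp only [hkM, StrongRep.mInv, Set.mem_ofPred_eq, Set.mem_add, Set.mem_image]
    constructor
    · rintro ⟨η, h1, h2⟩
      exact ⟨_, h1, _, ⟨η, h2, rfl⟩, sub_add_cancel _ _⟩
    · rintro ⟨y, h1, _, ⟨η, h2, rfl⟩, h⟩
      exact ⟨η, by rwa [← h, add_sub_cancel_right], h2⟩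
  · obtain ⟨k, hk, hkM⟩ :=
      StrongRep.exists_isStronglyRepresentative_parallel_sum hf hg B hB
    refine ⟨k, hk, ?_⟩
    have hadj : ∀ (x : E) (y : F), NormedSpace.inclusionInDoubleDual ℝ E x
        - StrongRep.adj (StrongRep.adj B) (NormedSpace.inclusionInDoubleDual ℝ F y)
        = NormedSpace.inclusionInDoubleDual ℝ E (x - B y) := by
      intro x y
      rw [map_sub]
      rfl
    ext x x'
    simp only [hkM, StrongRep.mInv, Set.mem_ofPred_eq, Set.mem_add, Set.mem_image]
    constructor
    · rintro ⟨η, h1, h2⟩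
      -- The range condition makes the multiplier canonical, `η = ŷ`; then `Bᵀᵀ ŷ` is the image of
      -- `B y`, and both memberships descend to `M f` and `M g`.
      obtain ⟨y, rfl⟩ := hR (Set.mem_iUnion.2 ⟨_, h2⟩)
      rw [hadj, ← hf.mem_M_iff] at h1
      rw [← hg.mem_M_iff] at h2
      exact ⟨_, h1, _, ⟨y, h2, rfl⟩, sub_add_cancel _ _⟩
    · rintro ⟨z, h1, _, ⟨y, h2, rfl⟩, rfl⟩
      refine ⟨NormedSpace.inclusionInDoubleDual ℝ F y, ?_, (hg.mem_M_iff _ _).1 h2⟩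
      rw [hadj, add_sub_cancel_right]
      exact (hf.mem_M_iff _ _).1 h1
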